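/- **Setting.** A *physical system* $\mathfrak S$ consists of a nonempty set $\mathcal O$ of observables, a set $\mathcal S$ of states with a distinguished null state $0$ and at least one other element, maps $T_{(\Delta;A)}:\mathcal S\to\mathcal S$ for $\Delta\subset\mathbb R$ Borel and $A\in\mathcal O$, with $T_{(\Delta;A)}(\rho)=0$ if $\Delta=\varnothing$ or $\rho=0$, and Borel measures $P_\rho(\,\cdot\,;A)$ on $\mathbb R$ which are probability measures for $\rho\ne 0$ and zero for $\rho=0$. Below "state" means non-null state, $P_\rho(\alpha;A)$ means $P_\rho(\{\alpha\};A)$, $T_{(\alpha;A)}$ means $T_{(\{\alpha\};A)}$, and $0/0=0$. The spectrum $\sigma(A)$ is the intersection of all Borel sets $\Delta$ with $P_\rho(\Delta;A)=1$ for all states $\rho$. The system is *finite-dimensional* if every $\sigma(A)$ is finite with $P_\rho(\sigma(A);A)=1$ for all states $\rho$, and $n=\dim\mathfrak S:=\sup_A|\sigma(A)|<\infty$. Events are pairs $(\Delta;A)$ with $\varnothing\neq\Delta\subset\sigma(A)$. The probability of a sequence of events is $P_\rho((\Delta_1;A_1),\dots,(\Delta_m;A_m))=\prod_{i}P_{\rho_{i-1}}(\Delta_i;A_i)$,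 where $\rho_0=\rho$, $\rho_i=T_{(\Delta_i;A_i)}(\rho_{i-1})$. For $f:\sigma(A)\to\sigma(B)$ write $B=f(A)$ if $P_\rho(\Gamma;B)=P_\rho(f^{-1}(\Gamma);A)$ for all states $\rho$ and all $\Gamma\subset\sigma(B)$. Observables $A,B$ are *compatible* if $A=f(C)$, $B=g(C)$ for some $C,f,g$ (a *cone*). They *commute* if $P_\rho(\Delta;A)P_{T_{(\Delta;A)}(\rho)}(\Gamma;B)=P_\rho(\Gamma;B)P_{T_{(\Gamma;B)}(\rho)}(\Delta;A)$ for all states $\rho$ and all $\Delta\subset\sigma(A)$, $\Gamma\subset\sigma(B)$. A *projection* is an observable of the form $E=\chi_\Delta(A)$ with $\Delta\subset\sigma(A)$, and $\langle E\rangle_\rho:=P_\rho(1;E)$. The product $E\circ F$ of compatible projections is the observable equal to $(f\cdot g)(C)$ for every cone $E=f(C)$, $F=g(C)$; the zero observable $0$ is the one equal to $\chi_\varnothing(A)$ for all $A$; and $T_E:=T_{(1;E)}$, where $T_E\equiv 0$ if $1\notin\sigma(E)$. An observable $A$ is nondegenerate if $|\sigma(A)|=n$. A completely mixed state is a state $\emptyset$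 with $P_\emptyset(\alpha;A)=1/n$ for all nondegenerate $A$ and all $\alpha\in\sigma(A)$. A projection is rank-$1$ if it equals $\chi_{\{\alpha\}}(A)$ for some nondegenerate $A$ and $\alpha\in\sigma(A)$; the pure states are the states $\emptyset_E:=T_E(\emptyset)$ with $E$ rank-$1$. Assume that $\mathfrak S$ is finite-dimensional and satisfies the following postulates. 1. (Separability) Observables with the same distribution in all states are equal, and states giving the same distribution to all observables are equal. 2. (Subjective update) $\mathcal S\setminus\{0\}$ is closed under convex combinations and $\rho\mapsto P_\rho$ preserves them; and $P_{T_{(\Delta;A)}(\rho)}(s)=\sum_{\alpha\in\Delta}\frac{P_\rho(\alpha;A)}{P_\rho(\Delta;A)}P_{T_{(\alpha;A)}(\rho)}(s)$ for every event $(\Delta;A)$, state $\rho$ and nonempty finite sequence of events $s$. 3. (Self-compatibility) $P_{T_{(\alpha;A)}(\rho)}(\Delta;A)=P_\rho(\Delta\cap\{\alpha\};A)/P_\rho(\alpha;A)$ and $T_{(\alpha;A)}\circ T_{(\alpha';A)}=\delta_{\alpha,\alpha'}T_{(\alpha;A)}$ for all $\alpha,\alpha'\in\sigma(A)$, all $\Delta\subset\sigma(A)$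 and all states $\rho$. 4. (Observables and states) Every degenerate observable is a non-injective function of a nondegenerate one; for $A$ nondegenerate and $f:\sigma(A)\to\mathbb R$ there is an observable $f(A)$; a completely mixed state $\emptyset$ exists; and every state is a convex combination of states obtained from $\emptyset$ by finitely many updates by events. 5. (Compatibility) If $A=f(C)$ and $B=g(C)$, then $P_\rho((\Delta;A),(\Gamma;B))=P_\rho(f^{-1}(\Delta)\cap g^{-1}(\Gamma);C)$ for all states $\rho$, $\Delta\subset\sigma(A)$, $\Gamma\subset\sigma(B)$, and $T_{(\alpha;A)}\circ T_{(\beta;B)}=T_{\chi_{\{\alpha\}}(A)\circ\chi_{\{\beta\}}(B)}$ for all $\alpha\in\sigma(A)$, $\beta\in\sigma(B)$. 6. (Commutativity) Commuting observables are compatible. 7. (Eigenstates) If $F$ is rank-$1$ and $P_{\emptyset_F}(\alpha;A)=1$ for some $\alpha\in\sigma(A)$, then $F$ and $A$ are compatible; if $A$ is nondegenerate and a state $\rho$ has $P_\rho(\alpha;A)=1$ for some $\alpha\in\sigma(A)$, then $\rho$ is pure. 8. (Symmetry of transition probabilities) $\langle F\rangle_{\emptyset_E}=\langle E\rangle_{\emptyset_F}$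 for all rank-$1$ projections $E,F$. For projections $E,F$ write $E\le F$ if $E,F$ are compatible and $E\circ F=E$, and $E\perp F$ if $E,F$ are compatible and $E\circ F=0$. **Proposition (Ordering).** (i) For all projections $E,F$: $E\le F$ if and only if $\langle E\rangle_\rho\le\langle F\rangle_\rho$ for every state $\rho$. (ii) The relation $\le$ is a partial order on the set of projections (reflexive, antisymmetric and transitive). (iii) For all projections $E,F$: $E\perp F$ if and only if $\langle E\rangle_\rho+\langle F\rangle_\rho\le 1$ for every state $\rho$. -/

import Mathlib

open Set MeasureTheory
open scoped NNReal

universe u v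

/-- A physical system with observables `𝒪` and states `𝒮` (the null state `null` included).
`T Δ A` is the state update due to the event `(Δ; A)` and `P ρ A` is the Borel measure on `ℝ`
that the state `ρ` assigns to the observable `A`. Only Borel sets `Δ` matter. -/
structure PhysicalSystem (𝒪 : Type u) (𝒮 : Type v) where
  null : 𝒮
  T : Set ℝ → 𝒪 → 𝒮 → 𝒮
  P : 𝒮 → 𝒪 → Measure ℝ
  nonempty_obs : Nonempty 𝒪
  exists_state : ∃ ρ : 𝒮, ρ ≠ null
  T_empty : ∀ A ρ, T ∅ A ρ = null
  T_null : ∀ Δ A, MeasurableSet Δ → T Δ A null = null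
  P_null : ∀ A, P null A = 0
  P_prob : ∀ ρ A, ρ ≠ null → IsProbabilityMeasure (P ρ A)

namespace PhysicalSystem

variable {𝒪 : Type u} {𝒮 : Type v}

/-- `P_ρ(Δ; A)` as a real number. -/
noncomputable def prob (S : PhysicalSystem 𝒪 𝒮) (ρ : 𝒮) (A : 𝒪) (Δ : Set ℝ) : ℝ :=
  (S.P ρ A).real Δ

/-- The spectrum `σ(A)`: the intersection of all Borel sets having probability one in every
(non-null) state. -/
def spectrum (S : PhysicalSystem 𝒪 𝒮) (A : 𝒪) : Set ℝ :=
  ⋂₀ {Δ | MeasurableSet Δ ∧ ∀ ρ, ρ ≠ S.null → S.P ρ A Δ = 1}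

/-- The dimension of the system: the supremum of the cardinalities of the spectra. -/
noncomputable def dim (S : PhysicalSystem 𝒪 𝒮) : ℕ :=
  sSup (Set.range fun A : 𝒪 => (S.spectrum A).ncard)

/-- Finite-dimensional systems: every spectrum is a finite set, which carries all the
probability, and the cardinalities of the spectra are bounded. -/
structure FiniteDimensional (S : PhysicalSystem 𝒪 𝒮) : Prop where
  finite_spectrum : ∀ A, (S.spectrum A).Finite
  prob_spectrum : ∀ ρ A, ρ ≠ S.null → S.P ρ A (S.spectrum A) = 1
  bddAbove_card : BddAbove (Set.range fun A : 𝒪 => (S.spectrum A).ncard)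

/-- An observable event `(Δ; A)`, `∅ ≠ Δ ⊆ σ(A)`. -/
def IsEvent (S : PhysicalSystem 𝒪 𝒮) (e : Set ℝ × 𝒪) : Prop :=
  e.1 ⊆ S.spectrum e.2 ∧ e.1.Nonempty

/-- The update determined by a sequence of events, the head of the list occurring first. -/
def seqUpdate (S : PhysicalSystem 𝒪 𝒮) : List (Set ℝ × 𝒪) → 𝒮 → 𝒮
  | [], ρ => ρ
  | e :: l, ρ => S.seqUpdate l (S.T e.1 e.2 ρ)

/-- The probability `∏ᵢ P_ρ(Aᵢ^{Δᵢ} | (A_k^{Δ_k})_{k < i})` of a sequence of events, the head of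
the list occurring first. -/
noncomputable def seqProb (S : PhysicalSystem 𝒪 𝒮) : List (Set ℝ × 𝒪) → 𝒮 → ℝ
  | [], _ => 1
  | e :: l, ρ => S.prob ρ e.2 e.1 * S.seqProb l (S.T e.1 e.2 ρ)

/-- `B = f(A)`: `f` maps `σ(A)` to `σ(B)` and, in every state, the distribution of `B` is the
pushforward along `f` of that of `A`. Only the restriction of `f` to `σ(A)` matters. -/
def IsFunctionVia (S : PhysicalSystem 𝒪 𝒮) (B A : 𝒪) (f : ℝ → ℝ) : Prop :=
  MapsTo f (S.spectrum A) (S.spectrum B) ∧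
    ∀ ρ, ρ ≠ S.null → ∀ Γ ⊆ S.spectrum B,
      S.prob ρ B Γ = S.prob ρ A (S.spectrum A ∩ f ⁻¹' Γ)

/-- The characteristic function of `Δ`. -/
noncomputable def chi (Δ : Set ℝ) : ℝ → ℝ := Δ.indicator fun _ => 1

/-- Two observables are compatible if they are functions of a common observable. -/
def Compatible (S : PhysicalSystem 𝒪 𝒮) (A B : 𝒪) : Prop :=
  ∃ C f g, S.IsFunctionVia A C f ∧ S.IsFunctionVia B C g

/-- Two observables commute if they satisfy the Bayes rule. -/
def Commutes (S : PhysicalSystem 𝒪 𝒮) (A B : 𝒪) : Prop :=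
  ∀ ρ, ρ ≠ S.null → ∀ Δ ⊆ S.spectrum A, ∀ Γ ⊆ S.spectrum B,
    S.prob ρ A Δ * S.prob (S.T Δ A ρ) B Γ = S.prob ρ B Γ * S.prob (S.T Γ B ρ) A Δ

/-- `E` is a projection: `E = χ_Δ(A)` for some event `Δ ⊆ σ(A)`. -/
def IsProjection (S : PhysicalSystem 𝒪 𝒮) (E : 𝒪) : Prop :=
  ∃ A, ∃ Δ ⊆ S.spectrum A, S.IsFunctionVia E A (chi Δ)

/-- The expectation `⟨E⟩_ρ = P_ρ({1}; E)` of a projection. -/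
noncomputable def expect (S : PhysicalSystem 𝒪 𝒮) (ρ : 𝒮) (E : 𝒪) : ℝ := S.prob ρ E {1}

/-- `G = E ∘ F`: `E` and `F` are compatible and `G = (f · g)(C)` for every cone
`E = f(C)`, `F = g(C)`. -/
def IsProduct (S : PhysicalSystem 𝒪 𝒮) (E F G : 𝒪) : Prop :=
  S.Compatible E F ∧
    ∀ C f g, S.IsFunctionVia E C f → S.IsFunctionVia F C g → S.IsFunctionVia G C (f * g)

/-- `Z` is the zero observable: `Z = χ_∅(A)` for every `A`. -/
def IsZero (S : PhysicalSystem 𝒪 𝒮) (Z : 𝒪) : Prop :=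
  ∀ A, S.IsFunctionVia Z A (chi ∅)

/-- `E ≤ F`: `E` and `F` are compatible and `E ∘ F = E`. -/
def Le (S : PhysicalSystem 𝒪 𝒮) (E F : 𝒪) : Prop :=
  S.IsProduct E F E

/-- `E ⊥ F`: `E` and `F` are compatible and `E ∘ F = 0`. -/
def Orthogonal (S : PhysicalSystem 𝒪 𝒮) (E F : 𝒪) : Prop :=
  ∃ Z, S.IsZero Z ∧ S.IsProduct E F Z

/-- The update `T_E` of a projection `E`, given by the event `(1; E)`; it is the trivial update
`ρ ↦ null` if `1 ∉ σ(E)`, that is, if `E` is zero. -/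
def projUpdate (S : PhysicalSystem 𝒪 𝒮) (E : 𝒪) (ρ : 𝒮) : 𝒮 :=
  S.T ({1} ∩ S.spectrum E) E ρ

/-- An observable is nondegenerate if its spectrum has `dim` elements. -/
def Nondegenerate (S : PhysicalSystem 𝒪 𝒮) (A : 𝒪) : Prop :=
  (S.spectrum A).ncard = S.dim

/-- The completely mixed state: uniform on the spectrum of each nondegenerate observable. -/
def IsCompletelyMixed (S : PhysicalSystem 𝒪 𝒮) (m : 𝒮) : Prop :=
  m ≠ S.null ∧ ∀ A, S.Nondegenerate A → ∀ α ∈ S.spectrum A, S.prob m A {α} = 1 / (S.dim : ℝ)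

/-- Experimentally accessible states: those obtained from the completely mixed state by a finite
(possibly empty) sequence of updates. -/
def IsAccessible (S : PhysicalSystem 𝒪 𝒮) (ρ : 𝒮) : Prop :=
  ρ ≠ S.null ∧ ∃ m, S.IsCompletelyMixed m ∧
    ∃ l : List (Set ℝ × 𝒪), (∀ e ∈ l, S.IsEvent e) ∧ ρ = S.seqUpdate l m

/-- Rank-one projections: `E = χ_Δ(A)` with `A` nondegenerate and `Δ ⊆ σ(A)` a one-point set. -/
def IsRankOne (S : PhysicalSystem 𝒪 𝒮) (E : 𝒪) : Prop :=
  ∃ A, S.Nondegenerate A ∧ ∃ Δ ⊆ S.spectrum A, Δ.ncard = 1 ∧ S.IsFunctionVia E A (chi Δ)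

/-- Pure states: the updates `T_E(m)` of the completely mixed state by rank-one projections. -/
def IsPure (S : PhysicalSystem 𝒪 𝒮) (ρ : 𝒮) : Prop :=
  ∃ m E, S.IsCompletelyMixed m ∧ S.IsRankOne E ∧ ρ = S.projUpdate E m

/-- Separability: states separate observables and observables separate states. -/
structure Separability (S : PhysicalSystem 𝒪 𝒮) : Prop where
  obs_ext : ∀ A B, (∀ ρ, ρ ≠ S.null → S.P ρ A = S.P ρ B) → A = B
  state_ext : ∀ ρ ρ', (∀ A, S.P ρ A = S.P ρ' A) → ρ = ρ'

/-- Subjective update: (non-null) states are closed under convex combinations, which are formed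
at the level of the probabilities they assign, and updates by an event are mixtures of the
updates by its points. -/
structure SubjectiveUpdate (S : PhysicalSystem 𝒪 𝒮) : Prop where
  convex : ∀ ρ₁ ρ₂, ρ₁ ≠ S.null → ρ₂ ≠ S.null → ∀ s t : ℝ≥0, s + t = 1 →
    ∃ ρ, ρ ≠ S.null ∧ ∀ A, S.P ρ A = s • S.P ρ₁ A + t • S.P ρ₂ A
  update : ∀ (A : 𝒪) (Δ : Finset ℝ), (Δ : Set ℝ) ⊆ S.spectrum A → Δ.Nonempty →
    ∀ ρ, ρ ≠ S.null → ∀ l : List (Set ℝ × 𝒪), l ≠ [] → (∀ e ∈ l, S.IsEvent e) →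
      S.seqProb l (S.T (Δ : Set ℝ) A ρ) =
        ∑ α ∈ Δ, S.prob ρ A {α} / S.prob ρ A (Δ : Set ℝ) * S.seqProb l (S.T {α} A ρ)

/-- Self-compatibility, with the convention `0 / 0 = 0`. -/
structure SelfCompatibility (S : PhysicalSystem 𝒪 𝒮) : Prop where
  cond : ∀ A, ∀ α ∈ S.spectrum A, ∀ ρ, ρ ≠ S.null → ∀ Δ ⊆ S.spectrum A,
    S.prob (S.T {α} A ρ) A Δ = S.prob ρ A (Δ ∩ {α}) / S.prob ρ A {α}
  update_self : ∀ A, ∀ α ∈ S.spectrum A, ∀ ρ, S.T {α} A (S.T {α} A ρ) = S.T {α} A ρ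
  update_ne : ∀ A, ∀ α ∈ S.spectrum A, ∀ α' ∈ S.spectrum A, α ≠ α' →
    ∀ ρ, S.T {α} A (S.T {α'} A ρ) = S.null

/-- Observables and states. -/
structure ObservablesAndStates (S : PhysicalSystem 𝒪 𝒮) : Prop where
  coarse_graining : ∀ A, ¬ S.Nondegenerate A →
    ∃ C f, S.Nondegenerate C ∧ S.IsFunctionVia A C f ∧ ¬ InjOn f (S.spectrum C)
  functions : ∀ A, S.Nondegenerate A → ∀ f : ℝ → ℝ, ∃ B, S.IsFunctionVia B A f
  exists_mixed : ∃ m, S.IsCompletelyMixed m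
  convex_hull : ∀ ρ, ρ ≠ S.null → ∃ (k : ℕ) (w : Fin k → ℝ≥0) (r : Fin k → 𝒮),
    (∑ i, w i = 1) ∧ (∀ i, S.IsAccessible (r i)) ∧ ∀ A, S.P ρ A = ∑ i, w i • S.P (r i) A

/-- Compatibility: the sequential distribution of compatible observables is the pushforward of
the distribution of any cone, and sequential updates are updates by product projections. -/
structure CompatibilityPostulate (S : PhysicalSystem 𝒪 𝒮) : Prop where
  pushforward : ∀ A B C f g, S.IsFunctionVia A C f → S.IsFunctionVia B C g →
    ∀ ρ, ρ ≠ S.null → ∀ Δ ⊆ S.spectrum A, ∀ Γ ⊆ S.spectrum B,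
      S.seqProb [(Δ, A), (Γ, B)] ρ = S.prob ρ C (S.spectrum C ∩ (f ⁻¹' Δ ∩ g ⁻¹' Γ))
  update : ∀ A B, S.Compatible A B → ∀ α ∈ S.spectrum A, ∀ β ∈ S.spectrum B, ∀ E F G,
    S.IsFunctionVia E A (chi {α}) → S.IsFunctionVia F B (chi {β}) → S.IsProduct E F G →
      ∀ ρ, S.T {α} A (S.T {β} B ρ) = S.projUpdate G ρ

/-- Eigenstates: a pure state `T_F(m)` predicting an outcome of `A` with certainty comes from an
`F` compatible with `A`, and only pure states predict nondegenerate observables. -/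
structure EigenstatePostulate (S : PhysicalSystem 𝒪 𝒮) : Prop where
  compatible : ∀ m, S.IsCompletelyMixed m → ∀ F, S.IsRankOne F → ∀ A, ∀ α ∈ S.spectrum A,
    S.prob (S.projUpdate F m) A {α} = 1 → S.Compatible F A
  pure : ∀ A, S.Nondegenerate A → ∀ ρ, ρ ≠ S.null → ∀ α ∈ S.spectrum A,
    S.prob ρ A {α} = 1 → S.IsPure ρ

/-- The postulates on the system: separability, subjective update, self-compatibility,
observables and states, compatibility, commuting observables are compatible, eigenstates, and
symmetry of the transition probabilities `P(E → F) = ⟨F⟩_{T_E(m)}` of rank-one projections. -/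
structure Postulates (S : PhysicalSystem 𝒪 𝒮) : Prop where
  separability : S.Separability
  subjectiveUpdate : S.SubjectiveUpdate
  selfCompatibility : S.SelfCompatibility
  observables : S.ObservablesAndStates
  compatibility : S.CompatibilityPostulate
  commutativity : ∀ A B, S.Commutes A B → S.Compatible A B
  eigenstates : S.EigenstatePostulate
  transition_symm : ∀ m, S.IsCompletelyMixed m → ∀ E F, S.IsRankOne E → S.IsRankOne F →
    S.expect (S.projUpdate E m) F = S.expect (S.projUpdate F m) E

end PhysicalSystem

namespace PhysicalSystem

variable {𝒪 : Type u} {𝒮 : Type v} {S : PhysicalSystem 𝒪 𝒮}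

theorem prob_null (A : 𝒪) (Δ : Set ℝ) : S.prob S.null A Δ = 0 := by
  simp [prob, S.P_null]

theorem prob_nonneg (ρ : 𝒮) (A : 𝒪) (Δ : Set ℝ) : 0 ≤ S.prob ρ A Δ :=
  measureReal_nonneg

theorem prob_mono {ρ : 𝒮} (hρ : ρ ≠ S.null) (A : 𝒪) {Δ Γ : Set ℝ} (h : Δ ⊆ Γ) :
    S.prob ρ A Δ ≤ S.prob ρ A Γ := by
  have := S.P_prob ρ A hρ
  exact measureReal_mono h

theorem prob_le_one {ρ : 𝒮} (hρ : ρ ≠ S.null) (A : 𝒪) (Δ : Set ℝ) : S.prob ρ A Δ ≤ 1 := by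
  have := S.P_prob ρ A hρ
  exact measureReal_le_one

theorem prob_empty (ρ : 𝒮) (A : 𝒪) : S.prob ρ A ∅ = 0 := measureReal_empty

theorem FiniteDimensional.prob_spectrum_real (hfin : S.FiniteDimensional) {ρ : 𝒮}
    (hρ : ρ ≠ S.null) (A : 𝒪) : S.prob ρ A (S.spectrum A) = 1 := by
  simp [prob, Measure.real, hfin.prob_spectrum ρ A hρ]

/-- All the probability sits on the spectrum. -/
theorem FiniteDimensional.P_congr (hfin : S.FiniteDimensional) {ρ : 𝒮} (hρ : ρ ≠ S.null) {A : 𝒪}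
    {Δ Γ : Set ℝ} (h : S.spectrum A ∩ Δ = S.spectrum A ∩ Γ) : S.P ρ A Δ = S.P ρ A Γ := by
  have := S.P_prob ρ A hρ
  have h0 : ∀ᵐ x ∂(S.P ρ A), x ∈ S.spectrum A :=
    (mem_ae_iff_prob_eq_one (hfin.finite_spectrum A).measurableSet).2 (hfin.prob_spectrum ρ A hρ)
  refine measure_congr ?_
  filter_upwards [h0] with x hx
  have hx' := Set.ext_iff.1 h x
  simp only [Set.mem_inter_iff, hx, true_and] at hx'
  exact propext hx'

theorem FiniteDimensional.prob_congr (hfin : S.FiniteDimensional) {ρ : 𝒮} (hρ : ρ ≠ S.null)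
    {A : 𝒪} {Δ Γ : Set ℝ} (h : S.spectrum A ∩ Δ = S.spectrum A ∩ Γ) :
    S.prob ρ A Δ = S.prob ρ A Γ := by
  simp only [prob, Measure.real, hfin.P_congr hρ h]

theorem FiniteDimensional.prob_eq_one_of_subset (hfin : S.FiniteDimensional) {ρ : 𝒮}
    (hρ : ρ ≠ S.null) {A : 𝒪} {Δ : Set ℝ} (h : S.spectrum A ⊆ Δ) : S.prob ρ A Δ = 1 := by
  rw [← hfin.prob_spectrum_real hρ A]
  exact hfin.prob_congr hρ (by rw [inter_eq_left.2 h, inter_self])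

theorem prob_finset (ρ : 𝒮) (A : 𝒪) (Δ : Finset ℝ) :
    S.prob ρ A (Δ : Set ℝ) = ∑ α ∈ Δ, S.prob ρ A {α} := by
  by_cases hρ : ρ = S.null
  · subst hρ
    simp [prob_null]
  · have := S.P_prob ρ A hρ
    exact (sum_measureReal_singleton Δ).symm

theorem FiniteDimensional.mem_spectrum (hfin : S.FiniteDimensional) {ρ : 𝒮} {A : 𝒪} {α : ℝ}
    (h : S.prob ρ A {α} ≠ 0) : α ∈ S.spectrum A := by
  by_contra hα
  have hρ : ρ ≠ S.null := by
    rintro rfl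
    exact h (prob_null A _)
  apply h
  rw [hfin.prob_congr hρ (Γ := ∅) (by simpa using hα), prob_empty]

theorem FiniteDimensional.exists_prob_ne_zero (hfin : S.FiniteDimensional) {A : 𝒪} {α : ℝ}
    (h : α ∈ S.spectrum A) : ∃ ρ, ρ ≠ S.null ∧ S.prob ρ A {α} ≠ 0 := by
  by_contra! hall
  have hmem : S.spectrum A \ {α} ∈
      {Δ | MeasurableSet Δ ∧ ∀ ρ, ρ ≠ S.null → S.P ρ A Δ = 1} := by
    refine ⟨((hfin.finite_spectrum A).subset sdiff_subset).measurableSet, fun ρ hρ => ?_⟩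
    have := S.P_prob ρ A hρ
    have h0 : S.P ρ A {α} = 0 := (measureReal_eq_zero_iff).1 (hall ρ hρ)
    rw [measure_sdiff_null h0, hfin.prob_spectrum ρ A hρ]
  exact (Set.mem_sInter.1 h _ hmem).2 rfl

/-- The probabilities of the two outcomes of a two-valued observable add up to one. -/
theorem FiniteDimensional.prob_add_eq_one (hfin : S.FiniteDimensional) {ρ : 𝒮} (hρ : ρ ≠ S.null)
    {A : 𝒪} {a a' : ℝ} (haa' : a ≠ a') (hA : S.spectrum A ⊆ {a, a'}) :
    S.prob ρ A {a} + S.prob ρ A {a'} = 1 := by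
  rw [← hfin.prob_eq_one_of_subset hρ hA, show ({a, a'} : Set ℝ) = (({a, a'} : Finset ℝ) : Set ℝ)
    by simp, prob_finset, Finset.sum_pair haa']

/-- The pushforward formula for `B = f(A)` holds for arbitrary sets. -/
theorem IsFunctionVia.prob_eq {A B : 𝒪} {f : ℝ → ℝ} (h : S.IsFunctionVia B A f)
    (hfin : S.FiniteDimensional) {ρ : 𝒮} (hρ : ρ ≠ S.null) (Γ : Set ℝ) :
    S.prob ρ B Γ = S.prob ρ A (f ⁻¹' Γ) := by
  rw [hfin.prob_congr hρ (Γ := S.spectrum B ∩ Γ) (by simp), h.2 ρ hρ _ inter_subset_left]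
  refine hfin.prob_congr hρ ?_
  ext x
  have := @h.1 x
  simp only [mem_inter_iff, mem_preimage]
  tauto

theorem IsFunctionVia.congr {A B : 𝒪} {f g : ℝ → ℝ} (h : S.IsFunctionVia B A f)
    (hfg : EqOn f g (S.spectrum A)) : S.IsFunctionVia B A g := by
  refine ⟨h.1.congr hfg, fun ρ hρ Γ hΓ => ?_⟩
  rw [h.2 ρ hρ Γ hΓ, hfg.inter_preimage_eq]

theorem IsFunctionVia.prob_le {A B : 𝒪} {f : ℝ → ℝ} (h : S.IsFunctionVia B A f)
    (hfin : S.FiniteDimensional) {ρ : 𝒮} (hρ : ρ ≠ S.null) (α : ℝ) :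
    S.prob ρ A {α} ≤ S.prob ρ B {f α} := by
  rw [h.prob_eq hfin hρ]
  exact prob_mono hρ A (by simp)

theorem isFunctionVia_id (A : 𝒪) : S.IsFunctionVia A A id :=
  ⟨mapsTo_id _, fun ρ _ Γ hΓ => by rw [preimage_id, inter_eq_right.2 hΓ]⟩

theorem IsFunctionVia.surjOn {A B : 𝒪} {f : ℝ → ℝ} (h : S.IsFunctionVia B A f)
    (hfin : S.FiniteDimensional) : SurjOn f (S.spectrum A) (S.spectrum B) := by
  intro β hβ
  obtain ⟨ρ, hρ, hne⟩ := hfin.exists_prob_ne_zero hβ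
  by_contra hnot
  apply hne
  rw [h.2 ρ hρ _ (singleton_subset_iff.2 hβ)]
  convert prob_empty ρ A
  ext x
  simp only [mem_inter_iff, mem_preimage, mem_singleton_iff, mem_empty_iff_false, iff_false]
  exact fun hx => hnot ⟨x, hx⟩

theorem isProjection_spectrum_subset (hfin : S.FiniteDimensional) {E : 𝒪}
    (hE : S.IsProjection E) : S.spectrum E ⊆ {0, 1} := by
  obtain ⟨A, Δ, -, h⟩ := hE
  intro e he
  obtain ⟨a, -, rfl⟩ := h.surjOn hfin he
  by_cases ha : a ∈ Δ <;> simp [chi, ha]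

section Update

variable {ρ : 𝒮} {A : 𝒪} {α : ℝ}

theorem update_ne_null (hfin : S.FiniteDimensional) (hself : S.SelfCompatibility)
    (h : S.prob ρ A {α} ≠ 0) :
    S.T {α} A ρ ≠ S.null ∧ S.prob (S.T {α} A ρ) A {α} = 1 := by
  have hρ : ρ ≠ S.null := by
    rintro rfl
    exact h (prob_null A _)
  have hα := hfin.mem_spectrum h
  have h1 : S.prob (S.T {α} A ρ) A {α} = 1 := by
    rw [hself.cond A α hα ρ hρ _ (singleton_subset_iff.2 hα), inter_self, div_self h]
  refine ⟨fun h0 => ?_, h1⟩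
  rw [h0, prob_null] at h1
  exact zero_ne_one h1

/-- The sequential probability of two events is additive in the first event. -/
theorem prob_mul_prob_update (hupd : S.SubjectiveUpdate) {B : 𝒪} {Δ : Finset ℝ} {Γ : Set ℝ}
    (hΔ : (Δ : Set ℝ) ⊆ S.spectrum A) (hΓ : Γ ⊆ S.spectrum B) (hρ : ρ ≠ S.null) :
    S.prob ρ A Δ * S.prob (S.T Δ A ρ) B Γ =
      ∑ α ∈ Δ, S.prob ρ A {α} * S.prob (S.T {α} A ρ) B Γ := by
  rcases Γ.eq_empty_or_nonempty with rfl | hΓ'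
  · simp [prob_empty]
  rcases Δ.eq_empty_or_nonempty with rfl | hΔ'
  · simp [prob_empty]
  have h := hupd.update A Δ hΔ hΔ' ρ hρ [(Γ, B)] (by simp) (by simpa using ⟨hΓ, hΓ'⟩)
  simp only [seqProb, mul_one] at h
  rw [h, Finset.mul_sum]
  refine Finset.sum_congr rfl fun α hα => ?_
  rcases eq_or_ne (S.prob ρ A Δ) 0 with h0 | h0
  · have : S.prob ρ A {α} = 0 := le_antisymm
      (h0 ▸ prob_mono hρ A (by simpa using hα)) (prob_nonneg _ _ _)
    simp [this]
  · field_simp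

end Update

/-- It suffices to check the Bayes rule on single outcomes. -/
theorem commutes_of_singletons (hfin : S.FiniteDimensional) (hupd : S.SubjectiveUpdate)
    {A B : 𝒪}
    (h : ∀ ρ, ρ ≠ S.null → ∀ α ∈ S.spectrum A, ∀ β ∈ S.spectrum B,
      S.prob ρ A {α} * S.prob (S.T {α} A ρ) B {β} =
        S.prob ρ B {β} * S.prob (S.T {β} B ρ) A {α}) :
    S.Commutes A B := by
  intro ρ hρ Δ hΔ Γ hΓ
  lift Δ to Finset ℝ using (hfin.finite_spectrum A).subset hΔ
  lift Γ to Finset ℝ using (hfin.finite_spectrum B).subset hΓ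
  rw [prob_mul_prob_update hupd hΔ hΓ hρ, prob_mul_prob_update hupd hΓ hΔ hρ]
  simp only [prob_finset, Finset.mul_sum]
  rw [Finset.sum_comm]
  exact Finset.sum_congr rfl fun β hβ => Finset.sum_congr rfl fun α hα =>
    h ρ hρ α (hΔ hα) β (hΓ hβ)

theorem exists_nondegenerate_via (hobs : S.ObservablesAndStates) (A : 𝒪) :
    ∃ C f, S.Nondegenerate C ∧ S.IsFunctionVia A C f := by
  by_cases hA : S.Nondegenerate A
  · exact ⟨A, id, hA, isFunctionVia_id A⟩
  · obtain ⟨C, f, hC, hf, -⟩ := hobs.coarse_graining A hA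
    exact ⟨C, f, hC, hf⟩

theorem FiniteDimensional.dim_pos (hfin : S.FiniteDimensional) : 0 < S.dim := by
  obtain ⟨A⟩ := S.nonempty_obs
  obtain ⟨ρ, hρ⟩ := S.exists_state
  have hne : (S.spectrum A).Nonempty := by
    rw [nonempty_iff_ne_empty]
    intro h
    have := hfin.prob_spectrum ρ A hρ
    simp [h] at this
  exact ((ncard_pos (hfin.finite_spectrum A)).2 hne).trans_le
    (le_csSup hfin.bddAbove_card ⟨A, rfl⟩)

/-- `chi {a} (A)` has the outcome `1` exactly when `A` has the outcome `a`. -/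
theorem IsFunctionVia.prob_chi_singleton {A E : 𝒪} {a : ℝ} (h : S.IsFunctionVia E A (chi {a}))
    (hfin : S.FiniteDimensional) {ρ : 𝒮} (hρ : ρ ≠ S.null) :
    S.prob ρ E {1} = S.prob ρ A {a} := by
  rw [h.prob_eq hfin hρ]
  congr 1
  ext x
  by_cases hx : x = a <;> simp [chi, hx]

/-- If an outcome `a` of a nondegenerate observable forces the outcome `y` of `Y`, then measuring
`Y` first does not change the probability of `y` followed by `a`. -/
theorem prob_mul_prob_update_of_certain (hfin : S.FiniteDimensional) (hpost : S.Postulates)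
    {A Y : 𝒪} {a y : ℝ} (hA : S.Nondegenerate A) (ha : a ∈ S.spectrum A)
    (hy : ∀ ρ, ρ ≠ S.null → S.prob ρ A {a} = 1 → S.prob ρ Y {y} = 1)
    {ρ : 𝒮} (hρ : ρ ≠ S.null) (hYρ : S.prob ρ Y {y} ≠ 0) :
    S.prob ρ Y {y} * S.prob (S.T {y} Y ρ) A {a} = S.prob ρ A {a} := by
  have hself := hpost.selfCompatibility
  obtain ⟨G, hG⟩ := hpost.observables.functions A hA (chi {a})
  obtain ⟨m, hm⟩ := hpost.observables.exists_mixed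
  have h1 : (1 : ℝ) ∈ S.spectrum G := by
    have := hG.1 ha
    simpa [chi] using this
  have hyY := hfin.mem_spectrum hYρ
  have hcert : ∀ τ, τ ≠ S.null → S.prob τ G {1} ≠ 0 → S.T {1} G τ ≠ S.null ∧
      S.prob (S.T {1} G τ) Y {y} = 1 := by
    intro τ _ hτ
    obtain ⟨hT, hT1⟩ := update_ne_null hfin hself hτ
    exact ⟨hT, hy _ hT (by rw [← hG.prob_chi_singleton hfin hT, hT1])⟩
  have hcomp : S.Compatible G Y := by
    refine hpost.eigenstates.compatible m hm G
      ⟨A, hA, {a}, singleton_subset_iff.2 ha, ncard_singleton a, hG⟩ Y y hyY ?_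
    rw [projUpdate, inter_eq_left.2 (singleton_subset_iff.2 h1)]
    refine (hcert m hm.1 ?_).2
    rw [hG.prob_chi_singleton hfin hm.1, hm.2 A hA a ha]
    have := hfin.dim_pos
    positivity
  obtain ⟨C, f, g, hf, hg⟩ := hcomp
  have hGY := hpost.compatibility.pushforward G Y C f g hf hg ρ hρ
    {1} (singleton_subset_iff.2 h1) {y} (singleton_subset_iff.2 hyY)
  have hYG := hpost.compatibility.pushforward Y G C g f hg hf ρ hρ
    {y} (singleton_subset_iff.2 hyY) {1} (singleton_subset_iff.2 h1)
  rw [inter_comm (g ⁻¹' {y}), ← hGY] at hYG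
  simp only [seqProb, mul_one] at hYG
  rw [← hG.prob_chi_singleton hfin (update_ne_null hfin hself hYρ).1, hYG,
    ← hG.prob_chi_singleton hfin hρ]
  rcases eq_or_ne (S.prob ρ G {1}) 0 with h0 | h0
  · simp [h0]
  · rw [(hcert ρ hρ h0).2, mul_one]

/-- If the outcome `x` of `X` is never more likely than the outcome `y` of `Y`, then measuring
`y` first does not change the probability of `x`. -/
theorem prob_mul_prob_update_of_le (hfin : S.FiniteDimensional) (hpost : S.Postulates)
    {X Y : 𝒪} {x y : ℝ} (hle : ∀ ρ, ρ ≠ S.null → S.prob ρ X {x} ≤ S.prob ρ Y {y})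
    {ρ : 𝒮} (hρ : ρ ≠ S.null) :
    S.prob ρ Y {y} * S.prob (S.T {y} Y ρ) X {x} = S.prob ρ X {x} := by
  rcases eq_or_ne (S.prob ρ Y {y}) 0 with h0 | h0
  · rw [h0, zero_mul]
    exact le_antisymm (prob_nonneg _ _ _) (h0 ▸ hle ρ hρ)
  obtain ⟨A, f, hA, hf⟩ := exists_nondegenerate_via hpost.observables X
  have hfinite : (S.spectrum A ∩ f ⁻¹' {x}).Finite :=
    (hfin.finite_spectrum A).subset inter_subset_left
  have hsum : ∀ τ, τ ≠ S.null →
      S.prob τ X {x} = ∑ a ∈ hfinite.toFinset, S.prob τ A {a} := by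
    intro τ hτ
    rw [← prob_finset, hfinite.coe_toFinset, hf.prob_eq hfin hτ]
    exact hfin.prob_congr hτ (by simp)
  rw [hsum _ (update_ne_null hfin hpost.selfCompatibility h0).1, hsum _ hρ, Finset.mul_sum]
  refine Finset.sum_congr rfl fun a ha => ?_
  obtain ⟨haA, hax⟩ := hfinite.mem_toFinset.1 ha
  obtain rfl : f a = x := hax
  refine prob_mul_prob_update_of_certain hfin hpost hA haA (fun τ hτ hτa => ?_) hρ h0
  exact le_antisymm (prob_le_one hτ Y _)
    (hτa ▸ (hf.prob_le hfin hτ a).trans (hle τ hτ))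

/-- Two-valued observables are compatible as soon as an outcome of the first is never more likely
than some outcome of the second. -/
theorem compatible_of_prob_le (hfin : S.FiniteDimensional) (hpost : S.Postulates)
    {X Y : 𝒪} {x x' y y' : ℝ} (hx : x ≠ x') (hy : y ≠ y')
    (hX : S.spectrum X ⊆ {x, x'}) (hY : S.spectrum Y ⊆ {y, y'})
    (hle : ∀ ρ, ρ ≠ S.null → S.prob ρ X {x} ≤ S.prob ρ Y {y}) : S.Compatible X Y := by
  refine hpost.commutativity X Y
    (commutes_of_singletons hfin hpost.subjectiveUpdate fun ρ hρ α hα β hβ => ?_)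
  have hle' : ∀ τ, τ ≠ S.null → S.prob τ Y {y'} ≤ S.prob τ X {x'} := fun τ hτ => by
    linarith [hle τ hτ, hfin.prob_add_eq_one hτ hx hX, hfin.prob_add_eq_one hτ hy hY]
  have hYX := prob_mul_prob_update_of_le hfin hpost hle hρ
  have hXY := prob_mul_prob_update_of_le hfin hpost hle' hρ
  have total : ∀ (A B : 𝒪) (a b b' : ℝ), b ≠ b' → S.spectrum B ⊆ {b, b'} →
      S.prob ρ A {a} * S.prob (S.T {a} A ρ) B {b} +
        S.prob ρ A {a} * S.prob (S.T {a} A ρ) B {b'} = S.prob ρ A {a} := by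
    intro A B a b b' hb hB
    rcases eq_or_ne (S.prob ρ A {a}) 0 with h0 | h0
    · simp [h0]
    · rw [← mul_add, hfin.prob_add_eq_one
        (update_ne_null hfin hpost.selfCompatibility h0).1 hb hB, mul_one]
  have hsX := hfin.prob_add_eq_one hρ hx hX
  have hsY := hfin.prob_add_eq_one hρ hy hY
  have hY1 := total Y X y x x' hx hX
  have hX1 := total X Y x' y y' hy hY
  -- the outcome `x` forces `y`, and `y'` forces `x'`
  have forced : ∀ (A B : 𝒪) (a b : ℝ),
      (∀ τ, τ ≠ S.null → S.prob τ A {a} ≤ S.prob τ B {b}) →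
      S.prob ρ A {a} * S.prob (S.T {a} A ρ) B {b} = S.prob ρ A {a} := by
    intro A B a b hAB
    rcases eq_or_ne (S.prob ρ A {a}) 0 with h0 | h0
    · simp [h0]
    · obtain ⟨hT, hT1⟩ := update_ne_null hfin hpost.selfCompatibility h0
      rw [le_antisymm (prob_le_one hT B _) (hT1 ▸ hAB _ hT), mul_one]
  have hx1 := forced X Y x y hle
  have hx2 := total X Y x y y' hy hY
  have hy1 := forced Y X y' x' hle'
  have hy2 := total Y X y' x x' hx hX
  rcases hX hα with rfl | rfl <;> rcases hY hβ with rfl | rfl <;> linarith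

/-- In a cone of `X` and `Y`, an outcome of `X` that is never more likely than an outcome of `Y`
forces the latter. -/
theorem cone_apply_eq_of_prob_le (hfin : S.FiniteDimensional) (hself : S.SelfCompatibility)
    {X Y C : 𝒪} {x y : ℝ} {f g : ℝ → ℝ} (hf : S.IsFunctionVia X C f)
    (hg : S.IsFunctionVia Y C g) (hle : ∀ ρ, ρ ≠ S.null → S.prob ρ X {x} ≤ S.prob ρ Y {y})
    {c : ℝ} (hc : c ∈ S.spectrum C) (hfc : f c = x) : g c = y := by
  subst hfc
  obtain ⟨ρ, hρ, hne⟩ := hfin.exists_prob_ne_zero hc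
  obtain ⟨hT, hT1⟩ := update_ne_null hfin hself hne
  have h1 := hf.prob_le hfin hT c
  have h2 := hg.prob_le hfin hT c
  have h3 := hle _ hT
  by_contra hgc
  have h4 : S.prob (S.T {c} C ρ) Y {g c} + S.prob (S.T {c} C ρ) Y {y} ≤ 1 := by
    rw [← Finset.sum_pair (f := fun b => S.prob (S.T {c} C ρ) Y {b}) hgc, ← prob_finset]
    exact prob_le_one hT _ _
  linarith

theorem exists_isZero (hfin : S.FiniteDimensional) (hobs : S.ObservablesAndStates) :
    ∃ Z, S.IsZero Z := by
  obtain ⟨A₀⟩ := S.nonempty_obs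
  obtain ⟨B, -, hB, -⟩ := exists_nondegenerate_via hobs A₀
  obtain ⟨Z, hZ⟩ := hobs.functions B hB (chi ∅)
  have hsub : S.spectrum Z ⊆ {0} := by
    intro z hz
    obtain ⟨b, -, rfl⟩ := hZ.surjOn hfin hz
    simp [chi]
  have hchi : ∀ x, chi ∅ x = 0 := by simp [chi]
  obtain ⟨ρ₀, hρ₀⟩ := S.exists_state
  have h0 : (0 : ℝ) ∈ S.spectrum Z := by
    apply hfin.mem_spectrum (ρ := ρ₀)
    rw [hfin.prob_eq_one_of_subset hρ₀ hsub]
    exact one_ne_zero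
  refine ⟨Z, fun A => ⟨fun x _ => by rwa [hchi], fun ρ hρ Γ hΓ => ?_⟩⟩
  by_cases hΓ0 : (0 : ℝ) ∈ Γ
  · rw [hfin.prob_eq_one_of_subset hρ (hsub.trans (singleton_subset_iff.2 hΓ0)),
      hfin.prob_eq_one_of_subset hρ]
    exact fun x hx => ⟨hx, by simpa [hchi] using hΓ0⟩
  · have hΓe : Γ = ∅ := eq_empty_of_forall_notMem fun z hz => by
      have : z = 0 := hsub (hΓ hz)
      exact hΓ0 (this ▸ hz)
    simp [hΓe, prob_empty]

theorem le_iff_expect_le (hfin : S.FiniteDimensional) (hpost : S.Postulates) {E F : 𝒪}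
    (hE : S.IsProjection E) (hF : S.IsProjection F) :
    S.Le E F ↔ ∀ ρ, ρ ≠ S.null → S.expect ρ E ≤ S.expect ρ F := by
  have hEs := isProjection_spectrum_subset hfin hE
  have hFs := isProjection_spectrum_subset hfin hF
  constructor
  · rintro ⟨⟨C, f, g, hf, hg⟩, h⟩ ρ hρ
    have hfg := h C f g hf hg
    rw [expect, expect, hfg.prob_eq hfin hρ, hg.prob_eq hfin hρ,
      hfin.prob_congr hρ (Γ := S.spectrum C ∩ (f * g) ⁻¹' {1}) (by simp)]
    refine prob_mono hρ C ?_
    rintro c ⟨hc, hfgc⟩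
    rcases hFs (hg.1 hc) with h0 | h0
    · simp [h0] at hfgc
    · exact h0
  · intro hle
    rw [pair_comm] at hEs hFs
    refine ⟨compatible_of_prob_le hfin hpost one_ne_zero one_ne_zero hEs hFs hle, ?_⟩
    intro C f g hf hg
    refine hf.congr fun c hc => ?_
    rcases hEs (hf.1 hc) with h1 | h0
    · have := cone_apply_eq_of_prob_le hfin hpost.selfCompatibility hf hg hle hc h1
      simp [this]
    · have : f c = 0 := h0
      simp [this]

theorem orthogonal_iff_expect_add_le_one (hfin : S.FiniteDimensional) (hpost : S.Postulates)
    {E F : 𝒪} (hE : S.IsProjection E) (hF : S.IsProjection F) :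
    S.Orthogonal E F ↔ ∀ ρ, ρ ≠ S.null → S.expect ρ E + S.expect ρ F ≤ 1 := by
  have hEs := isProjection_spectrum_subset hfin hE
  have hFs := isProjection_spectrum_subset hfin hF
  constructor
  · rintro ⟨Z, hZ, ⟨C, f, g, hf, hg⟩, h⟩ ρ hρ
    have hfg := (h C f g hf hg).prob_eq hfin hρ {1}
    rw [(hZ C).prob_eq hfin hρ, show chi ∅ ⁻¹' {(1 : ℝ)} = ∅ by ext; simp [chi],
      prob_empty] at hfg
    have hFsum := hfin.prob_add_eq_one hρ zero_ne_one hFs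
    suffices hle : S.prob ρ E {1} ≤ S.prob ρ F {0} by
      rw [expect, expect]
      linarith
    rw [hf.prob_eq hfin hρ, hg.prob_eq hfin hρ]
    have := S.P_prob ρ C hρ
    calc S.prob ρ C (f ⁻¹' {1})
        = S.prob ρ C (S.spectrum C ∩ f ⁻¹' {1}) := hfin.prob_congr hρ (by simp)
      _ ≤ S.prob ρ C (g ⁻¹' {0} ∪ (f * g) ⁻¹' {1}) := by
          refine prob_mono hρ C ?_
          rintro c ⟨hc, hfc⟩
          have hfc' : f c = 1 := hfc
          rcases hFs (hg.1 hc) with h0 | h0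
          · exact Or.inl h0
          · have h0' : g c = 1 := h0
            exact Or.inr (by simp [hfc', h0'])
      _ ≤ S.prob ρ C (g ⁻¹' {0}) + S.prob ρ C ((f * g) ⁻¹' {1}) := measureReal_union_le _ _
      _ = S.prob ρ C (g ⁻¹' {0}) := by rw [← hfg, add_zero]
  · intro hle
    have hle' : ∀ ρ, ρ ≠ S.null → S.prob ρ E {1} ≤ S.prob ρ F {0} := fun ρ hρ => by
      have := hle ρ hρ
      rw [expect, expect] at this
      linarith [hfin.prob_add_eq_one hρ zero_ne_one hFs]
    obtain ⟨Z, hZ⟩ := exists_isZero hfin hpost.observables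
    have hEs' : S.spectrum E ⊆ {1, 0} := by rwa [pair_comm]
    refine ⟨Z, hZ, compatible_of_prob_le hfin hpost one_ne_zero zero_ne_one hEs' hFs hle', ?_⟩
    intro C f g hf hg
    refine (hZ C).congr fun c hc => ?_
    rcases hEs (hf.1 hc) with h0 | h1
    · have : f c = 0 := h0
      simp [chi, this]
    · have := cone_apply_eq_of_prob_le hfin hpost.selfCompatibility hf hg hle' hc h1
      simp [chi, this]

/-- Projections with the same expectations are equal. -/
theorem projection_ext (hfin : S.FiniteDimensional) (hsep : S.Separability) {E F : 𝒪}
    (hE : S.IsProjection E) (hF : S.IsProjection F)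
    (h : ∀ ρ, ρ ≠ S.null → S.expect ρ E = S.expect ρ F) : E = F := by
  have hEs := isProjection_spectrum_subset hfin hE
  have hFs := isProjection_spectrum_subset hfin hF
  have hpts : ∀ ρ, ρ ≠ S.null → ∀ α : ℝ, S.prob ρ E {α} = S.prob ρ F {α} := by
    intro ρ hρ α
    have h1 : S.prob ρ E {1} = S.prob ρ F {1} := h ρ hρ
    by_cases hα : α ∈ ({0, 1} : Set ℝ)
    · rcases hα with rfl | rfl
      · linarith [hfin.prob_add_eq_one hρ zero_ne_one hEs,
          hfin.prob_add_eq_one hρ zero_ne_one hFs]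
      · exact h1
    · rw [not_ne_iff.1 fun hne => hα (hEs (hfin.mem_spectrum (ρ := ρ) hne)),
        not_ne_iff.1 fun hne => hα (hFs (hfin.mem_spectrum (ρ := ρ) hne))]
  refine hsep.obs_ext E F fun ρ hρ => ?_
  have hPE := S.P_prob ρ E hρ
  have hPF := S.P_prob ρ F hρ
  ext Δ -
  classical
  have hΔ : ∀ A : 𝒪, S.spectrum A ⊆ {0, 1} →
      S.P ρ A Δ = S.P ρ A (({0, 1} : Finset ℝ).filter (· ∈ Δ) : Finset ℝ) := fun A hA => by
    refine hfin.P_congr hρ ?_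
    ext x
    have := @hA x
    simp only [mem_inter_iff, Finset.coe_filter, Finset.mem_insert, Finset.mem_singleton,
      mem_ofPred_eq, mem_insert_iff, mem_singleton_iff] at this ⊢
    tauto
  rw [hΔ E hEs, hΔ F hFs, ← measureReal_eq_measureReal_iff]
  change S.prob ρ E _ = S.prob ρ F _
  rw [prob_finset, prob_finset]
  exact Finset.sum_congr rfl fun α _ => hpts ρ hρ α

end PhysicalSystem

theorem mainTheorem7 {𝒪 : Type u} {𝒮 : Type v} (S : PhysicalSystem 𝒪 𝒮)
    (hfin : S.FiniteDimensional) (hpost : S.Postulates) :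
    (∀ E F : 𝒪, S.IsProjection E → S.IsProjection F →
      (S.Le E F ↔ ∀ ρ : 𝒮, ρ ≠ S.null → S.expect ρ E ≤ S.expect ρ F)) ∧
    IsPartialOrder {E : 𝒪 // S.IsProjection E} (fun E F => S.Le E.1 F.1) ∧
    (∀ E F : 𝒪, S.IsProjection E → S.IsProjection F →
      (S.Orthogonal E F ↔ ∀ ρ : 𝒮, ρ ≠ S.null → S.expect ρ E + S.expect ρ F ≤ 1)) := by
  refine ⟨fun E F hE hF => PhysicalSystem.le_iff_expect_le hfin hpost hE hF, ?_,
    fun E F hE hF => PhysicalSystem.orthogonal_iff_expect_add_le_one hfin hpost hE hF⟩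
  have hle := fun E F : {E : 𝒪 // S.IsProjection E} =>
    PhysicalSystem.le_iff_expect_le hfin hpost E.2 F.2
  exact {
    refl := fun E => (hle E E).2 fun _ _ => le_rfl
    trans := fun E F G hEF hFG => (hle E G).2 fun ρ hρ =>
      ((hle E F).1 hEF ρ hρ).trans ((hle F G).1 hFG ρ hρ)
    antisymm := fun E F hEF hFE => Subtype.ext <|
      PhysicalSystem.projection_ext hfin hpost.separability E.2 F.2 fun ρ hρ =>
        le_antisymm ((hle E F).1 hEF ρ hρ) ((hle F E).1 hFE ρ hρ) }
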